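/- Let $d$ be a natural number and let $\mathbb{J}$ be the $d\times d$ all-ones matrix. For complex $d\times d$ matrices $A,B,C$ with $\operatorname{diag}A=\operatorname{diag}B=\operatorname{diag}C$ put $$X_{(A,B,C)}=\sum_{i,j}A_{ij}\,|ij\rangle\langle ij|+\sum_{i\neq j}B_{ij}\,|ii\rangle\langle jj|+\sum_{i\neq j}C_{ij}\,|ij\rangle\langle ji|\quad\text{on }\mathbb{C}^d\otimes\mathbb{C}^d ;$$ these are exactly the LDOI (local diagonal orthogonal invariant) matrices, i.e. those $X$ with $(O\otimes O)X(O\otimes O)^*=X$ for all diagonal orthogonal $O$. A matrix $X$ on $\mathbb{C}^d\otimes\mathbb{C}^d$ is called PPT if both $X$ and its partial transpose $(\mathrm{id}\otimes T)(X)$ are positive semidefinite; it is called separable if it is a finite sum of matrices $|v\rangle\langle v|\otimes|w\rangle\langle w|$ with $v,w\in\mathbb{C}^d$; and it is called entangled if it is positive semidefinite and not separable. Let $\mathrm{Corr}_d$ be the set of positive semidefinite complex $d\times d$ matrices with all diagonal entries equal to $1$, and let $\mathbb{T}^d=\{z\in\mathbb{C}^d: |z_i|=1\text{ for all }i\}$.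 Theorem. For every complex $d\times d$ matrix $C$ with all diagonal entries equal to $1$: 1. $X_{(\mathbb{J},\mathbb{J},C)}$ is PPT if and only if $C\in\mathrm{Corr}_d$; 2. $X_{(\mathbb{J},\mathbb{J},C)}$ is separable if and only if $C\in\operatorname{conv}\{|z\rangle\langle z| : z\in\mathbb{T}^d\}$. Moreover $\operatorname{conv}\{|z\rangle\langle z| : z\in\mathbb{T}^d\}\subseteq\mathrm{Corr}_d$. In particular, for every $d\geq 4$ there is a matrix $C$ with unit diagonal such that the LDOI matrix $X_{(\mathbb{J},\mathbb{J},C)}$ is both PPT and entangled. -/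

import Mathlib

namespace LDOI

open scoped Kronecker ComplexOrder

/-- The rank-one matrix `|v⟩⟨w| = v w*`. -/
def ketbra {ι : Type*} (v w : ι → ℂ) : Matrix ι ι ℂ :=
  Matrix.vecMulVec v (star w)

/-- The matrix `X_(A,B,C)` on `ℂ^d ⊗ ℂ^d`, in the product basis `|ij⟩` indexed by `(i, j)`:
`∑_{i,j} A_ij |ij⟩⟨ij| + ∑_{i≠j} B_ij |ii⟩⟨jj| + ∑_{i≠j} C_ij |ij⟩⟨ji|`.
Here `Matrix.single p q c` is `c |p⟩⟨q|`. It is used for triples whose diagonals agree. -/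
def ldoiMatrix {d : ℕ} (A B C : Matrix (Fin d) (Fin d) ℂ) :
    Matrix (Fin d × Fin d) (Fin d × Fin d) ℂ :=
  (∑ i, ∑ j, Matrix.single (i, j) (i, j) (A i j))
    + (∑ i, ∑ j with i ≠ j, Matrix.single (i, i) (j, j) (B i j))
    + (∑ i, ∑ j with i ≠ j, Matrix.single (i, j) (j, i) (C i j))

/-- The all-ones matrix `𝕁`. -/
def allOnes (d : ℕ) : Matrix (Fin d) (Fin d) ℂ :=
  Matrix.of fun _ _ => 1

/-- Local diagonal orthogonal invariance: `(O ⊗ O) X (O ⊗ O)* = X` for every diagonal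
orthogonal matrix `O`. -/
def IsLDOI {d : ℕ} (X : Matrix (Fin d × Fin d) (Fin d × Fin d) ℂ) : Prop :=
  ∀ O ∈ Matrix.orthogonalGroup (Fin d) ℝ, O.IsDiag →
    let U : Matrix (Fin d) (Fin d) ℂ := O.map Complex.ofReal
    (U ⊗ₖ U) * X * (U ⊗ₖ U).conjTranspose = X

/-- The partial transpose `(id ⊗ T)(X)`, transposing the second tensor factor. -/
def partialTranspose {d : ℕ} (X : Matrix (Fin d × Fin d) (Fin d × Fin d) ℂ) :
    Matrix (Fin d × Fin d) (Fin d × Fin d) ℂ :=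
  Matrix.of fun p q => X (p.1, q.2) (q.1, p.2)

/-- `X` is PPT: both `X` and its partial transpose are positive semidefinite. -/
def IsPPT {d : ℕ} (X : Matrix (Fin d × Fin d) (Fin d × Fin d) ℂ) : Prop :=
  X.PosSemidef ∧ (partialTranspose X).PosSemidef

/-- `X` is separable: a finite sum of matrices `|v⟩⟨v| ⊗ |w⟩⟨w|`. -/
def IsSeparable {d : ℕ} (X : Matrix (Fin d × Fin d) (Fin d × Fin d) ℂ) : Prop :=
  ∃ (N : ℕ) (v w : Fin N → Fin d → ℂ),
    X = ∑ k, ketbra (v k) (v k) ⊗ₖ ketbra (w k) (w k)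

/-- `X` is entangled: positive semidefinite but not separable. -/
def IsEntangled {d : ℕ} (X : Matrix (Fin d × Fin d) (Fin d × Fin d) ℂ) : Prop :=
  X.PosSemidef ∧ ¬ IsSeparable X

/-- The set `Corr_d` of complex correlation matrices: positive semidefinite, unit diagonal. -/
def Corr (d : ℕ) : Set (Matrix (Fin d) (Fin d) ℂ) :=
  {Z | Z.PosSemidef ∧ ∀ i, Z i i = 1}

/-- The set `𝕋^d` of phase vectors: all entries have modulus one. -/
def phaseVectors (d : ℕ) : Set (Fin d → ℂ) :=
  {z | ∀ i, ‖z i‖ = 1}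

/-- The set `conv {|z⟩⟨z| : z ∈ 𝕋^d}`. -/
def phaseHull (d : ℕ) : Set (Matrix (Fin d) (Fin d) ℂ) :=
  convexHull ℝ ((fun z => ketbra z z) '' phaseVectors d)

end LDOI

namespace LDOI

open scoped Kronecker ComplexOrder
open Matrix

variable {d : ℕ}

/-! Partial transposition swaps `B` and `C`. Both matrices split into a block on the vectors `|ii⟩`
and blocks on the pairs `{|ij⟩, |ji⟩}`, all obtained from `𝕁` or `C`, so PPT reduces to positivity
of `C`. In a separable decomposition, the all-ones block on the `|ii⟩` forces each `v n i * w n i`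
to be independent of `i`; then `C` is a mixture of phase matrices (`mem_phaseHull_of_isSeparable`).
Conversely, averaging product vectors over signs realises each phase matrix
(`isSeparable_ldoiMatrix_ketbra`). For `d ≥ 4`, a rank-two correlation matrix whose range contains
no phase vector lies outside the hull. -/

/-! ### Entries, block decomposition and PPT -/

theorem sum_sum_eq_single {α : Type*} [Fintype α] {f : α → α → ℂ} (a b : α)
    (h : ∀ x y, ¬(x = a ∧ y = b) → f x y = 0) : ∑ x, ∑ y, f x y = f a b := by
  rw [Fintype.sum_eq_single a fun x hx => Finset.sum_eq_zero fun y _ => h x y fun hxy => hx hxy.1,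
    Fintype.sum_eq_single b fun y hy => h a y fun hxy => hy hxy.2]

theorem ldoiMatrix_apply (A B C : Matrix (Fin d) (Fin d) ℂ) (i j k l : Fin d) :
    ldoiMatrix A B C (i, j) (k, l) =
      if i = k ∧ j = l then A i j
      else if i = j ∧ k = l then B i k
      else if i = l ∧ j = k then C i j else 0 := by
  have hA : (∑ a, ∑ b, Matrix.single (a, b) (a, b) (A a b)) (i, j) (k, l) =
      if i = k ∧ j = l then A i j else 0 := by
    simp only [Matrix.sum_apply, Matrix.single_apply, Prod.mk.injEq]
    rw [sum_sum_eq_single i j] <;> grind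
  have hB : (∑ a, ∑ b with a ≠ b, Matrix.single (a, a) (b, b) (B a b)) (i, j) (k, l) =
      if i ≠ k ∧ i = j ∧ k = l then B i k else 0 := by
    simp only [Matrix.sum_apply, Matrix.single_apply, Prod.mk.injEq]
    simp only [Finset.sum_filter]
    clear hA
    rw [sum_sum_eq_single i k] <;> grind
  have hC : (∑ a, ∑ b with a ≠ b, Matrix.single (a, b) (b, a) (C a b)) (i, j) (k, l) =
      if i ≠ j ∧ i = l ∧ j = k then C i j else 0 := by
    simp only [Matrix.sum_apply, Matrix.single_apply, Prod.mk.injEq]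
    simp only [Finset.sum_filter]
    clear hA hB
    rw [sum_sum_eq_single i j] <;> grind
  rw [ldoiMatrix, Matrix.add_apply, Matrix.add_apply, hA, hB, hC]
  by_cases h1 : i = k <;> by_cases h2 : j = l <;> by_cases h3 : i = j <;> grind

theorem ketbra_apply {ι : Type*} (v w : ι → ℂ) (i j : ι) :
    ketbra v w i j = v i * star (w j) := rfl

theorem ketbra_posSemidef {ι : Type*} [Finite ι] (v : ι → ℂ) : (ketbra v v).PosSemidef :=
  Matrix.posSemidef_vecMulVec_self_star v

theorem allOnes_eq_ketbra (d : ℕ) : allOnes d = ketbra 1 1 := by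
  ext i j
  simp [allOnes, ketbra_apply]

theorem allOnes_posSemidef (d : ℕ) : (allOnes d).PosSemidef :=
  allOnes_eq_ketbra d ▸ ketbra_posSemidef 1

/-- The diagonal-pair block plus the blocks of the unordered pairs `{i, j}`, `i ≠ j`. -/
theorem ldoiMatrix_allOnes_eq_sum (B C : Matrix (Fin d) (Fin d) ℂ) (hB : ∀ i, B i i = 1)
    (hC : ∀ i, C i i = 1) :
    ldoiMatrix (allOnes d) B C =
      diagonal (fun p : Fin d × Fin d => if p.1 = p.2 then (1 : ℂ) else 0) *
          B.submatrix Prod.fst Prod.fst *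
        (diagonal fun p : Fin d × Fin d => if p.1 = p.2 then (1 : ℂ) else 0)ᴴ +
      ∑ s : Sym2 (Fin d) with ¬ s.IsDiag,
        diagonal (fun p : Fin d × Fin d => if s(p.1, p.2) = s then (1 : ℂ) else 0) *
            C.submatrix Prod.fst Prod.fst *
          (diagonal fun p : Fin d × Fin d => if s(p.1, p.2) = s then (1 : ℂ) else 0)ᴴ := by
  ext ⟨i, j⟩ ⟨k, l⟩
  rw [ldoiMatrix_apply, Matrix.add_apply, Matrix.sum_apply, Finset.sum_filter]
  simp only [diagonal_conjTranspose, mul_diagonal, diagonal_mul, submatrix_apply, Pi.star_apply]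
  rw [Finset.sum_eq_single s(i, j)]
  · have := hB i
    have := hC i
    simp only [Sym2.mk_isDiag_iff, Sym2.eq_iff, allOnes, of_apply]
    by_cases h1 : i = k <;> by_cases h2 : j = l <;> by_cases h3 : i = j <;>
      by_cases h4 : k = l <;> simp_all <;> grind
  · intro s _ hs
    rw [if_neg (Ne.symm hs)]
    simp
  · simp

theorem ldoiMatrix_allOnes_posSemidef {B C : Matrix (Fin d) (Fin d) ℂ} (hB : B ∈ Corr d)
    (hC : C ∈ Corr d) : (ldoiMatrix (allOnes d) B C).PosSemidef := by
  rw [ldoiMatrix_allOnes_eq_sum B C hB.2 hC.2]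
  refine ((hB.1.submatrix _).mul_mul_conjTranspose_same _).add
    (Matrix.posSemidef_sum _ fun s _ => ?_)
  exact (hC.1.submatrix _).mul_mul_conjTranspose_same _

theorem allOnes_mem_Corr (d : ℕ) : allOnes d ∈ Corr d :=
  ⟨allOnes_posSemidef d, fun _ => rfl⟩

theorem partialTranspose_ldoiMatrix (A B C : Matrix (Fin d) (Fin d) ℂ) :
    partialTranspose (ldoiMatrix A B C) = ldoiMatrix A C B := by
  ext ⟨i, j⟩ ⟨k, l⟩
  simp only [partialTranspose, of_apply, ldoiMatrix_apply]
  by_cases h1 : i = k <;> by_cases h2 : j = l <;> by_cases h3 : i = j <;> grind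

theorem isPPT_iff_mem_Corr {C : Matrix (Fin d) (Fin d) ℂ} (hC : ∀ i, C i i = 1) :
    IsPPT (ldoiMatrix (allOnes d) (allOnes d) C) ↔ C ∈ Corr d := by
  rw [IsPPT, partialTranspose_ldoiMatrix]
  refine ⟨fun h => ⟨?_, hC⟩, fun h => ⟨ldoiMatrix_allOnes_posSemidef (allOnes_mem_Corr d) h,
    ldoiMatrix_allOnes_posSemidef h (allOnes_mem_Corr d)⟩⟩
  -- After partial transposition `C` is the principal block on the vectors `|ii⟩`.
  convert h.2.submatrix fun i : Fin d => (i, i)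
  ext i j
  rw [submatrix_apply, ldoiMatrix_apply]
  have := hC i
  by_cases hij : i = j <;> simp_all [allOnes]

theorem phaseHull_subset_Corr (d : ℕ) : phaseHull d ⊆ Corr d := by
  refine convexHull_min ?_ ?_
  · rintro _ ⟨z, hz, rfl⟩
    refine ⟨ketbra_posSemidef z, fun i => ?_⟩
    simp [ketbra_apply, Complex.mul_conj', hz i]
  · rintro M ⟨hM, hM'⟩ N ⟨hN, hN'⟩ a b ha hb hab
    refine ⟨(hM.smul ha).add (hN.smul hb), fun i => ?_⟩
    simp only [Matrix.add_apply, Matrix.smul_apply, hM', hN']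
    rw [← add_smul, hab, one_smul]

/-! ### Separability -/

theorem IsSeparable.add {X Y : Matrix (Fin d × Fin d) (Fin d × Fin d) ℂ}
    (hX : IsSeparable X) (hY : IsSeparable Y) : IsSeparable (X + Y) := by
  obtain ⟨N, v, w, rfl⟩ := hX
  obtain ⟨M, v', w', rfl⟩ := hY
  refine ⟨N + M, Fin.append v v', Fin.append w w', ?_⟩
  simp [Fin.sum_univ_add]

theorem isSeparable_zero : IsSeparable (0 : Matrix (Fin d × Fin d) (Fin d × Fin d) ℂ) :=
  ⟨0, Fin.elim0, Fin.elim0, by simp⟩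

theorem isSeparable_ketbra_kronecker (v w : Fin d → ℂ) :
    IsSeparable (ketbra v v ⊗ₖ ketbra w w) :=
  ⟨1, fun _ => v, fun _ => w, by simp⟩

theorem IsSeparable.sum {ι : Type*} (s : Finset ι)
    {X : ι → Matrix (Fin d × Fin d) (Fin d × Fin d) ℂ} (hX : ∀ i ∈ s, IsSeparable (X i)) :
    IsSeparable (∑ i ∈ s, X i) :=
  Finset.sum_induction X IsSeparable (fun _ _ => IsSeparable.add) isSeparable_zero hX

theorem IsSeparable.smul {X : Matrix (Fin d × Fin d) (Fin d × Fin d) ℂ} (hX : IsSeparable X)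
    {c : ℝ} (hc : 0 ≤ c) : IsSeparable (c • X) := by
  obtain ⟨N, v, w, rfl⟩ := hX
  refine ⟨N, fun k => (Real.sqrt c : ℂ) • v k, w, ?_⟩
  rw [Finset.smul_sum]
  refine Finset.sum_congr rfl fun k _ => ?_
  ext ⟨i, j⟩ ⟨m, n⟩
  have h : (c : ℂ) = (Real.sqrt c : ℂ) * (Real.sqrt c : ℂ) := by
    rw [← Complex.ofReal_mul, Real.mul_self_sqrt hc]
  simp only [Matrix.smul_apply, kroneckerMap_apply, ketbra_apply, Pi.smul_apply, smul_eq_mul,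
    Complex.real_smul, star_mul', Complex.star_def, Complex.conj_ofReal]
  rw [h]
  ring

/-- Averages over independent signs vanish on monomials of degree four that are not products of
two squares. -/
theorem sum_sign_monomial (i j k l : Fin d) :
    ∑ ε : Fin d → ℤˣ, (((ε i * ε j * ε k * ε l : ℤˣ) : ℤ) : ℂ) =
      if i = k ∧ j = l ∨ i = j ∧ k = l ∨ i = l ∧ j = k then (2 : ℂ) ^ d else 0 := by
  split_ifs with h
  · have h1 (ε : Fin d → ℤˣ) : ε i * ε j * ε k * ε l = 1 := by
      rcases h with ⟨rfl, rfl⟩ | ⟨rfl, rfl⟩ | ⟨rfl, rfl⟩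
      · rw [mul_assoc, Int.units_mul_self]
      · rw [Int.units_mul_self, one_mul, Int.units_mul_self]
      · rw [mul_assoc (ε i), Int.units_mul_self, mul_one, Int.units_mul_self]
    simp [h1]
  -- Some index occurs an odd number of times; flipping its sign permutes the summands and negates
  -- the sum.
  · obtain ⟨δ, hδ⟩ : ∃ δ : Fin d → ℤˣ, δ i * δ j * δ k * δ l = -1 := by
      by_cases hij : i = j
      · subst hij
        have hkl : l ≠ k := fun hlk => h (.inr (.inl ⟨rfl, hlk.symm⟩))
        exact ⟨fun b => if b = k then -1 else 1, by by_cases hik : i = k <;> simp [hkl, hik]⟩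
      · by_cases hik : i = k
        · exact ⟨fun b => if b = j then -1 else 1, by grind⟩
        · by_cases hil : i = l
          · exact ⟨fun b => if b = j then -1 else 1, by grind⟩
          · exact ⟨fun b => if b = i then -1 else 1, by grind⟩
    have hflip := Equiv.sum_comp (Equiv.mulLeft δ) fun ε : Fin d → ℤˣ =>
      (((ε i * ε j * ε k * ε l : ℤˣ) : ℤ) : ℂ)
    have hneg (ε : Fin d → ℤˣ) : (δ * ε) i * (δ * ε) j * (δ * ε) k * (δ * ε) l =
        -(ε i * ε j * ε k * ε l) := by
      calc _ = (δ i * δ j * δ k * δ l) * (ε i * ε j * ε k * ε l) := by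
            simp only [Pi.mul_apply]; ac_rfl
        _ = _ := by rw [hδ, neg_one_mul]
    simp only [Equiv.coe_mulLeft, hneg, Units.val_neg, Int.cast_neg, Finset.sum_neg_distrib]
      at hflip
    exact self_eq_neg.mp hflip.symm

/-- With `v i ^ 2 = z i`, average the projections onto `εv ⊗ εv̄` over signs `ε`. The entries that
survive are `1`, except that `|ij⟩⟨ji|` receives `v i ^ 2 * star (v j) ^ 2 = z i * star (z j)`. -/
theorem isSeparable_ldoiMatrix_ketbra {z : Fin d → ℂ} (hz : z ∈ phaseVectors d) :
    IsSeparable (ldoiMatrix (allOnes d) (allOnes d) (ketbra z z)) := by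
  choose v hv using fun i => IsAlgClosed.exists_pow_nat_eq (z i) two_pos
  have hn (i : Fin d) : v i * star (v i) = 1 := by
    have h : ‖v i‖ ^ 2 = 1 := by rw [← norm_pow, hv, hz i]
    rw [Complex.star_def, Complex.mul_conj', ← Complex.ofReal_pow, h, Complex.ofReal_one]
  have hX : ldoiMatrix (allOnes d) (allOnes d) (ketbra z z) =
      ((2 : ℝ) ^ d)⁻¹ • ∑ ε : Fin d → ℤˣ,
        ketbra (fun i => ((ε i : ℤ) : ℂ) * v i) (fun i => ((ε i : ℤ) : ℂ) * v i) ⊗ₖ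
          ketbra (fun i => ((ε i : ℤ) : ℂ) * star (v i))
            (fun i => ((ε i : ℤ) : ℂ) * star (v i)) := by
    ext ⟨i, j⟩ ⟨k, l⟩
    have h2 : (2 : ℂ) ^ d ≠ 0 := by positivity
    have hterm (ε : Fin d → ℤˣ) :
        (ketbra (fun i => ((ε i : ℤ) : ℂ) * v i) (fun i => ((ε i : ℤ) : ℂ) * v i) ⊗ₖ
          ketbra (fun i => ((ε i : ℤ) : ℂ) * star (v i))
            (fun i => ((ε i : ℤ) : ℂ) * star (v i))) (i, j) (k, l) =
        (((ε i * ε j * ε k * ε l : ℤˣ) : ℤ) : ℂ) *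
          (v i * star (v j) * star (v k) * v l) := by
      simp only [kroneckerMap_apply, ketbra_apply, star_mul', star_intCast, star_star]
      push_cast
      ring
    rw [Matrix.smul_apply, Matrix.sum_apply, Finset.sum_congr rfl fun ε _ => hterm ε,
      ← Finset.sum_mul, sum_sign_monomial, ldoiMatrix_apply, Complex.real_smul]
    push_cast
    have hcancel (x : ℂ) : ((2 : ℂ) ^ d)⁻¹ * (2 ^ d * x) = x := inv_mul_cancel_left₀ h2 x
    split_ifs with h1 h3 h4 h5 h6 h7 h8 <;> try grind
    all_goals rw [hcancel]
    · obtain ⟨rfl, rfl⟩ := h1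
      have := hn i
      have := hn j
      simp only [allOnes, of_apply]
      grind
    · obtain ⟨rfl, rfl⟩ := h4
      have := hn i
      have := hn k
      simp only [allOnes, of_apply]
      grind
    · obtain ⟨rfl, rfl⟩ := h6
      rw [ketbra_apply, ← hv, ← hv, star_pow]
      ring
  rw [hX]
  exact (IsSeparable.sum _ fun ε _ => isSeparable_ketbra_kronecker _ _).smul (by positivity)

theorem ldoiMatrix_allOnes_convexCombination (M N : Matrix (Fin d) (Fin d) ℂ) {a b : ℝ}
    (hab : a + b = 1) :
    ldoiMatrix (allOnes d) (allOnes d) (a • M + b • N) =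
      a • ldoiMatrix (allOnes d) (allOnes d) M + b • ldoiMatrix (allOnes d) (allOnes d) N := by
  have hab' : (a : ℂ) + b = 1 := by exact_mod_cast hab
  ext ⟨i, j⟩ ⟨k, l⟩
  simp only [Matrix.add_apply, Matrix.smul_apply, ldoiMatrix_apply, Complex.real_smul, allOnes,
    of_apply]
  split_ifs <;> simp [hab']

theorem isSeparable_of_mem_phaseHull {C : Matrix (Fin d) (Fin d) ℂ} (hC : C ∈ phaseHull d) :
    IsSeparable (ldoiMatrix (allOnes d) (allOnes d) C) := by
  have hsub : phaseHull d ⊆ {M | IsSeparable (ldoiMatrix (allOnes d) (allOnes d) M)} := by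
    refine convexHull_min ?_ ?_
    · rintro _ ⟨z, hz, rfl⟩
      exact isSeparable_ldoiMatrix_ketbra hz
    · intro M hM N hN a b ha hb hab
      rw [Set.mem_ofPred_eq, ldoiMatrix_allOnes_convexCombination M N hab]
      exact (IsSeparable.smul hM ha).add (IsSeparable.smul hN hb)
  exact hsub hC

theorem mem_phaseHull_of_isSeparable {C : Matrix (Fin d) (Fin d) ℂ} (hC : ∀ i, C i i = 1)
    (h : IsSeparable (ldoiMatrix (allOnes d) (allOnes d) C)) : C ∈ phaseHull d := by
  obtain ⟨N, v, w, hX⟩ := h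
  have hent (i j k l : Fin d) : ldoiMatrix (allOnes d) (allOnes d) C (i, j) (k, l) =
      ∑ n, v n i * star (v n k) * (w n j * star (w n l)) := by
    rw [hX, Matrix.sum_apply]
    rfl
  have hB (i j : Fin d) : ∑ n, v n i * w n i * star (v n j * w n j) = 1 := by
    rw [← (show ldoiMatrix (allOnes d) (allOnes d) C (i, i) (j, j) = 1 by
      simp [ldoiMatrix_apply, allOnes]), hent]
    refine Finset.sum_congr rfl fun n _ => ?_
    rw [star_mul']
    ring
  have hCij (i j : Fin d) : C i j = ∑ n, v n i * star (v n j) * (w n j * star (w n i)) := by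
    rw [← hent, ldoiMatrix_apply]
    by_cases hij : i = j
    · subst hij
      simp [hC, allOnes]
    · simp [hij]
  -- the products `v n i * w n i` do not depend on `i`
  have hconst (n : Fin N) (i j : Fin d) : v n i * w n i = v n j * w n j := by
    have h0 : ∑ n, ((‖v n i * w n i - v n j * w n j‖ ^ 2 : ℝ) : ℂ) = 0 := by
      calc _ = ∑ n, (v n i * w n i * star (v n i * w n i) - v n i * w n i * star (v n j * w n j)
            - v n j * w n j * star (v n i * w n i) + v n j * w n j * star (v n j * w n j)) := by
            refine Finset.sum_congr rfl fun n _ => ?_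
            rw [Complex.ofReal_pow, ← Complex.mul_conj', ← Complex.star_def, star_sub]
            ring
        _ = 0 := by
            rw [Finset.sum_add_distrib, Finset.sum_sub_distrib, Finset.sum_sub_distrib,
              hB, hB, hB, hB]
            ring
    rw [← Complex.ofReal_sum, Complex.ofReal_eq_zero,
      Finset.sum_eq_zero_iff_of_nonneg fun _ _ => by positivity] at h0
    simpa [sub_eq_zero] using h0 n (Finset.mem_univ n)
  -- For `d = 0` there is no base index `o`, but the only matrix is already a phase matrix.
  rcases isEmpty_or_nonempty (Fin d) with hd | ⟨⟨o⟩⟩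
  · exact subset_convexHull ℝ _ ⟨1, fun i => hd.elim i, Subsingleton.elim _ _⟩
  -- The value `1` only keeps `z n` unimodular: if `v n i = 0`, the constant product vanishes and so
  -- does the weight of `z n`.
  let z (n : Fin N) (i : Fin d) : ℂ := if v n i = 0 then 1 else v n i / star (v n i)
  have hz (n : Fin N) : z n ∈ phaseVectors d := by
    intro i
    by_cases hv : v n i = 0
    · simp [z, hv]
    · simp [z, hv]
  have hsum : C = ∑ n, (‖v n o * w n o‖ ^ 2) • ketbra (z n) (z n) := by
    ext i j
    rw [hCij, Matrix.sum_apply]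
    refine Finset.sum_congr rfl fun n _ => ?_
    rw [Matrix.smul_apply, Complex.real_smul, Complex.ofReal_pow, ← Complex.mul_conj',
      ← Complex.star_def, ketbra_apply]
    have hi := hconst n o i
    have hj := hconst n o j
    by_cases ha : v n o * w n o = 0
    · rw [ha] at hi ⊢
      rcases mul_eq_zero.mp hi.symm with h | h <;> simp [h]
    · have hvi : v n i ≠ 0 := fun h => ha (by rw [hi, h, zero_mul])
      have hvj : v n j ≠ 0 := fun h => ha (by rw [hj, h, zero_mul])
      have hvi' : star (v n i) ≠ 0 := star_ne_zero.mpr hvi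
      have hvj' : star (v n j) ≠ 0 := star_ne_zero.mpr hvj
      nth_rewrite 1 [hj]
      rw [hi]
      simp only [z, hvi, hvj, if_false, star_div₀, star_star, star_mul']
      field_simp
  rw [hsum]
  refine (convex_convexHull ℝ _).sum_mem (fun _ _ => by positivity) ?_
    fun n _ => subset_convexHull ℝ _ ⟨z n, hz n, rfl⟩
  -- The weights sum to the `|oo⟩⟨oo|` entry, which is `1`.
  have h1 := hB o o
  simp only [Complex.star_def, Complex.mul_conj', ← Complex.ofReal_pow] at h1
  exact_mod_cast h1

theorem isSeparable_iff_mem_phaseHull {C : Matrix (Fin d) (Fin d) ℂ} (hC : ∀ i, C i i = 1) :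
    IsSeparable (ldoiMatrix (allOnes d) (allOnes d) C) ↔ C ∈ phaseHull d :=
  ⟨mem_phaseHull_of_isSeparable hC, isSeparable_of_mem_phaseHull⟩

/-- In every nonzero entry the four indices match in pairs, so the signs of `O` cancel. -/
theorem isLDOI_ldoiMatrix (A B C : Matrix (Fin d) (Fin d) ℂ) : IsLDOI (ldoiMatrix A B C) := by
  intro O hO hdiag U
  obtain ⟨o, rfl⟩ : ∃ o : Fin d → ℝ, O = diagonal o := ⟨_, hdiag.diagonal_diag.symm⟩
  have ho (i : Fin d) : (o i : ℂ) * o i = 1 := by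
    have h := congrFun (congrFun ((Matrix.mem_orthogonalGroup_iff (Fin d) ℝ).mp hO) i) i
    simp at h
    exact_mod_cast h
  have hU : U = diagonal fun i => (o i : ℂ) := by
    simp only [U]
    rw [diagonal_map Complex.ofReal_zero]
  rw [hU, diagonal_kronecker_diagonal, diagonal_conjTranspose]
  ext ⟨i, j⟩ ⟨k, l⟩
  simp only [mul_diagonal, diagonal_mul, Pi.star_apply, star_mul', Complex.star_def,
    Complex.conj_ofReal, ldoiMatrix_apply]
  have := ho i
  have := ho j
  have := ho k
  split_ifs <;> grind

/-! ### A correlation matrix outside the hull of the rank-one phase matrices -/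

/-- A separating functional: `M ↦ ∑ₐ ⟨gₐ|M|gₐ⟩` is positive on every phase matrix, hence on the
hull, but vanishes at `C`. -/
theorem notMem_phaseHull_of_annihilated {C : Matrix (Fin d) (Fin d) ℂ} {ι : Type*} [Fintype ι]
    (g : ι → Fin d → ℂ) (hC : ∀ a, C *ᵥ g a = 0)
    (hg : ∀ z ∈ phaseVectors d, ∃ a, star (g a) ⬝ᵥ z ≠ 0) : C ∉ phaseHull d := by
  intro h
  let f : Matrix (Fin d) (Fin d) ℂ → ℝ := fun M => (∑ a, star (g a) ⬝ᵥ (M *ᵥ g a)).re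
  have hf : IsLinearMap ℝ f := by
    refine ⟨fun M N => ?_, fun c M => ?_⟩
    · simp [f, add_mulVec, Finset.sum_add_distrib]
    · simp [f, smul_mulVec, Finset.mul_sum]
  have hpos : phaseHull d ⊆ {M | 0 < f M} := by
    refine convexHull_min ?_ (convex_halfSpace_gt hf 0)
    rintro _ ⟨z, hz, rfl⟩
    have hval (a : ι) : (star (g a) ⬝ᵥ (ketbra z z *ᵥ g a)).re = ‖star (g a) ⬝ᵥ z‖ ^ 2 := by
      have : star z ⬝ᵥ g a = star (star (g a) ⬝ᵥ z) := by
        rw [star_dotProduct]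
      rw [ketbra, vecMulVec_mulVec, dotProduct_smul, this, op_smul_eq_smul, smul_eq_mul,
        mul_comm, Complex.star_def, Complex.mul_conj', ← Complex.ofReal_pow, Complex.ofReal_re]
    obtain ⟨a, ha⟩ := hg z hz
    simp only [Set.mem_ofPred_eq, f, Complex.re_sum, hval]
    exact Finset.sum_pos' (fun _ _ => by positivity) ⟨a, Finset.mem_univ a, by positivity⟩
  have h0 := hpos h
  simp [f, hC] at h0

/-- Unimodular `x`, `y` cannot have both `|x + y| = √2` and `|x + i y| = √2`. -/
theorem not_sqrt_two_mul_eq_add {x y s t : ℂ} (hx : ‖x‖ = 1) (hy : ‖y‖ = 1) (hs : ‖s‖ = 1)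
    (ht : ‖t‖ = 1) (h1 : (Real.sqrt 2 : ℂ) * s = x + y)
    (h2 : (Real.sqrt 2 : ℂ) * t = x + Complex.I * y) : False := by
  have e1 := congrArg Complex.normSq h1
  have e2 := congrArg Complex.normSq h2
  have n (u : ℂ) (hu : ‖u‖ = 1) : Complex.normSq u = 1 := by
    rw [Complex.normSq_eq_norm_sq, hu, one_pow]
  rw [map_mul, n s hs, Complex.normSq_ofReal, Real.mul_self_sqrt zero_le_two] at e1
  rw [map_mul, n t ht, Complex.normSq_ofReal, Real.mul_self_sqrt zero_le_two] at e2
  have hx' := n x hx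
  have hy' := n y hy
  simp only [Complex.normSq_apply, Complex.add_re, Complex.add_im, Complex.mul_re, Complex.mul_im,
    Complex.I_re, Complex.I_im] at e1 e2 hx' hy'
  have a1 : x.re * y.re + x.im * y.im = 0 := by linarith
  have a2 : x.im * y.re - x.re * y.im = 0 := by linarith
  have : (x.re * x.re + x.im * x.im) * (y.re * y.re + y.im * y.im) = 0 := by
    linear_combination (x.re * y.re + x.im * y.im) * a1 + (x.im * y.re - x.re * y.im) * a2
  rw [hx', hy'] at this
  norm_num at this

theorem exists_mem_Corr_notMem_phaseHull (hd : 4 ≤ d) :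
    ∃ C : Matrix (Fin d) (Fin d) ℂ, C ∈ Corr d ∧ C ∉ phaseHull d := by
  obtain ⟨m, rfl⟩ := Nat.exists_eq_add_of_le' hd
  let r : ℂ := (Real.sqrt 2 : ℂ)
  have hr : r * r = 2 := by
    simp only [r]
    rw [← Complex.ofReal_mul, Real.mul_self_sqrt zero_le_two, Complex.ofReal_ofNat]
  have hr0 : r ≠ 0 := fun h => by simp [h] at hr
  have hrs : (starRingEnd ℂ) r = r := Complex.conj_ofReal _
  have hri : r⁻¹ * r⁻¹ = 2⁻¹ := by rw [← mul_inv, hr]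
  let e : Fin 4 → Fin (m + 4) := Fin.natAdd m
  -- `V * Vᴴ` is the Gram matrix of the unit rows `e₁`, `e₂`, `(e₁ + e₂)/√2`, `(e₁ + i e₂)/√2`,
  -- padded by copies of `e₁`. The vectors `g a` encode the two linear relations among the last four
  -- rows; orthogonality of `z` to both is the system excluded by `not_sqrt_two_mul_eq_add`.
  let V : Matrix (Fin (m + 4)) (Fin 2) ℂ := Matrix.of
    (Fin.append (fun _ : Fin m => ![1, 0]) ![![1, 0], ![0, 1], ![r⁻¹, r⁻¹], ![r⁻¹, Complex.I * r⁻¹]])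
  let g : Fin 2 → Fin (m + 4) → ℂ := fun a =>
    Fin.append (fun _ : Fin m => 0) (![![-1, -1, r, 0], ![-1, Complex.I, 0, r]] a)
  refine ⟨V * Vᴴ, ⟨posSemidef_self_mul_conjTranspose V, fun i => ?_⟩,
    notMem_phaseHull_of_annihilated g (fun a => ?_) fun z hz => ?_⟩
  · rw [mul_apply, Fin.sum_univ_two]
    induction i using Fin.addCases with
    | left i => simp [V]
    | right i =>
      fin_cases i <;> simp [V, hrs, hri]
      · norm_num
      · linear_combination hri - Complex.I_mul_I * (r⁻¹ * r⁻¹)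
  · rw [← mulVec_mulVec]
    have : Vᴴ *ᵥ g a = 0 := by
      ext b
      rw [mulVec, dotProduct, Fin.sum_univ_add, Fin.sum_univ_four]
      fin_cases a <;> fin_cases b <;> simp [V, g, hrs, hr0]
    rw [this, mulVec_zero]
  · by_contra! h
    have h0 := h 0
    have h1 := h 1
    simp [g, dotProduct, Fin.sum_univ_add, Fin.sum_univ_four] at h0 h1
    rw [hrs] at h0 h1
    refine not_sqrt_two_mul_eq_add (hz (e 0)) (hz (e 1)) (hz (e 2)) (hz (e 3)) ?_ ?_
    · linear_combination h0
    · linear_combination h1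

end LDOI

theorem mainTheorem7 (d : ℕ) :
    (∀ C : Matrix (Fin d) (Fin d) ℂ, (∀ i, C i i = 1) →
      (LDOI.IsPPT (LDOI.ldoiMatrix (LDOI.allOnes d) (LDOI.allOnes d) C) ↔ C ∈ LDOI.Corr d) ∧
      (LDOI.IsSeparable (LDOI.ldoiMatrix (LDOI.allOnes d) (LDOI.allOnes d) C) ↔
        C ∈ LDOI.phaseHull d)) ∧
    LDOI.phaseHull d ⊆ LDOI.Corr d ∧
    (4 ≤ d → ∃ C : Matrix (Fin d) (Fin d) ℂ, (∀ i, C i i = 1) ∧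
      LDOI.IsLDOI (LDOI.ldoiMatrix (LDOI.allOnes d) (LDOI.allOnes d) C) ∧
      LDOI.IsPPT (LDOI.ldoiMatrix (LDOI.allOnes d) (LDOI.allOnes d) C) ∧
      LDOI.IsEntangled (LDOI.ldoiMatrix (LDOI.allOnes d) (LDOI.allOnes d) C)) := by
  refine ⟨fun C hC => ⟨LDOI.isPPT_iff_mem_Corr hC, LDOI.isSeparable_iff_mem_phaseHull hC⟩,
    LDOI.phaseHull_subset_Corr d, fun hd => ?_⟩
  obtain ⟨C, hC, hC'⟩ := LDOI.exists_mem_Corr_notMem_phaseHull hd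
  have hppt := (LDOI.isPPT_iff_mem_Corr hC.2).mpr hC
  exact ⟨C, hC.2, LDOI.isLDOI_ldoiMatrix _ _ _, hppt, hppt.1,
    fun h => hC' ((LDOI.isSeparable_iff_mem_phaseHull hC.2).mp h)⟩
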